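/- For integers $a,b,m\ge 1$, an $(a,b,m)$-copartition is a triple of integer partitions $(\gamma,\rho,\sigma)$ such that each part of $\gamma$ is at least $a$ and congruent to $a \pmod m$, each part of $\sigma$ is at least $b$ and congruent to $b \pmod m$, and $\rho$ has the same number of parts as $\sigma$, each of size equal to $m$ times the number of parts of $\gamma$ (so $\rho=\emptyset$ if $\gamma$ or $\sigma$ is empty). Its size is the sum of all the parts of $\gamma$, $\rho$ and $\sigma$, and $\mathrm{cp}_{a,b,m}(n)$ denotes the number of $(a,b,m)$-copartitions of size $n$. **Corollary.** (1) For $r = 3, 14, 36, 47, 58, 69, 80, 91, 102, 113$, we have $\mathrm{cp}_{3,1,4}(121k+r)\equiv 0 \pmod 2$ for every nonnegative integer $k$. (2) For $r = 9, 31, 42, 53, 64, 75, 86, 97, 108, 119$, we have $\mathrm{cp}_{5,1,6}(121k+r)\equiv 0 \pmod 2$ for every nonnegative integer $k$. -/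

import Mathlib

/-- An `(a,b,m)`-copartition `(γ, ρ, σ)` (ground, rectangle, sky). Partitions are finite multisets
of positive integers. Every part of the ground is at least `a` and congruent to `a` modulo `m`;
every part of the sky is at least `b` and congruent to `b` modulo `m`; the rectangle has as many
parts as the sky, each equal to `m` times the number of parts of the ground (so it is the empty
partition when the ground is empty, parts of size zero being dropped). -/
@[ext]
structure Copartition (a b m : ℕ) where
  ground : Multiset ℕ
  rect : Multiset ℕ
  sky : Multiset ℕ
  ground_pos : ∀ x ∈ ground, 0 < x
  sky_pos : ∀ x ∈ sky, 0 < x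
  ground_parts : ∀ x ∈ ground, a ≤ x ∧ x ≡ a [MOD m]
  sky_parts : ∀ x ∈ sky, b ≤ x ∧ x ≡ b [MOD m]
  rect_eq : rect =
    (Multiset.replicate (Multiset.card sky) (m * Multiset.card ground)).filter (fun x => x ≠ 0)

namespace Copartition

/-- The size of a copartition: the sum of all parts of its three partitions. -/
def size {a b m : ℕ} (c : Copartition a b m) : ℕ :=
  c.ground.sum + c.rect.sum + c.sky.sum

theorem finite_multiset_sum_le (n : ℕ) :
    {s : Multiset ℕ | (∀ x ∈ s, 0 < x) ∧ s.sum ≤ n}.Finite := by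
  refine (Set.finite_Iic (n • (Multiset.range (n + 1)))).subset ?_
  rintro s ⟨hpos, hsum⟩
  rw [Set.mem_Iic, Multiset.le_iff_count]
  intro x
  by_cases hx : x ∈ s
  · have h1 : x ≤ s.sum := Multiset.le_sum_of_mem hx
    have h2 : Multiset.card s • 1 ≤ s.sum := Multiset.card_nsmul_le_sum (fun y hy => hpos y hy)
    have h3 : Multiset.count x s ≤ Multiset.card s := Multiset.count_le_card x s
    have h4 : 1 ≤ Multiset.count x (Multiset.range (n + 1)) := by
      rw [Multiset.one_le_count_iff_mem, Multiset.mem_range]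
      omega
    rw [Multiset.count_nsmul]
    simp only [smul_eq_mul, mul_one] at h2
    nlinarith
  · rw [Multiset.count_eq_zero_of_notMem hx]
    exact Nat.zero_le _

/-- There are only finitely many `(a,b,m)`-copartitions of a given size, so that counting them by
`Nat.card` is meaningful. -/
instance finite_size_eq (a b m n : ℕ) : Finite {c : Copartition a b m // c.size = n} := by
  have hfin := (finite_multiset_sum_le n).prod (finite_multiset_sum_le n)
  have := hfin.to_subtype
  refine Finite.of_injective
    (fun c : {c : Copartition a b m // c.size = n} =>
      (⟨(c.1.ground, c.1.sky), by
        have h := c.2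
        unfold size at h
        exact ⟨⟨c.1.ground_pos, by dsimp only; omega⟩, ⟨c.1.sky_pos, by dsimp only; omega⟩⟩⟩ :
        ({s : Multiset ℕ | (∀ x ∈ s, 0 < x) ∧ s.sum ≤ n} ×ˢ
          {s : Multiset ℕ | (∀ x ∈ s, 0 < x) ∧ s.sum ≤ n} : Set (Multiset ℕ × Multiset ℕ)))) ?_
  rintro ⟨c, hc⟩ ⟨d, hd⟩ h
  have h' : c.ground = d.ground ∧ c.sky = d.sky := Prod.mk.inj (congrArg Subtype.val h)
  apply Subtype.ext
  exact Copartition.ext h'.1 (by rw [c.rect_eq, d.rect_eq, h'.1, h'.2]) h'.2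

end Copartition

/-- `cp a b m n` is the number of `(a,b,m)`-copartitions of size `n`. -/
noncomputable def cp (a b m n : ℕ) : ℕ :=
  Nat.card {c : Copartition a b m // c.size = n}

/-!
Write the parts of the ground as `a + m i` and those of the sky as `b + m j`, and let `C(a, b)` be
the generating function of `cp a b m`. Removing an index `i = 0`, or lowering all the indices `i`
by one if there is none, gives `C(a, b) = q ^ a C(a, b + m) + C(a + m, b)`. Together with
`C(a, b) = C(b, a)` and `C(a, b) = 1 + O(q ^ min(a, b))` this recurrence forces
`C(a, b) = (q ^ (a + b); q ^ m)_∞ / ((q ^ a; q ^ m)_∞ (q ^ b; q ^ m)_∞)`.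

Modulo `2`, this quotient is `(q; q)_∞ (q ^ d; q ^ d)_∞` with `d = 4` for `(a, b, m) = (3, 1, 4)`
and `d = 3` for `(5, 1, 6)`. By the pentagonal number theorem its coefficient of `q ^ n` vanishes
unless `24 n + 1 + d = x ^ 2 + d y ^ 2` for some integers `x` and `y`. If `-d` is not a square
modulo a prime `p`, a value of this form divisible by `p` is divisible by `p ^ 2`; both `-4` and
`-3` are nonsquares modulo `11`.
-/

namespace Copartition

section Indices

variable {a b m : ℕ}

/-- The copartition whose ground has the parts `a + m * i` for `i ∈ p.1` and whose sky has the parts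
`b + m * j` for `j ∈ p.2`. This encoding of copartitions by pairs of arbitrary multisets makes the
recurrence in `a` and `b` transparent. -/
def ofIndices (ha : 0 < a) (hb : 0 < b) (p : Multiset ℕ × Multiset ℕ) : Copartition a b m where
  ground := p.1.map (a + m * ·)
  rect := (Multiset.replicate (Multiset.card (p.2.map (b + m * ·)))
    (m * Multiset.card (p.1.map (a + m * ·)))).filter (fun x => x ≠ 0)
  sky := p.2.map (b + m * ·)
  ground_pos := by simp [ha]
  sky_pos := by simp [hb]
  ground_parts := by simp [Nat.ModEq]
  sky_parts := by simp [Nat.ModEq]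
  rect_eq := rfl

/-- The size of the copartition encoded by a pair of multisets of indices. -/
def indexSize (a b m : ℕ) (p : Multiset ℕ × Multiset ℕ) : ℕ :=
  a * p.1.card + b * p.2.card + m * (p.1.sum + p.1.card * p.2.card + p.2.sum)

theorem sum_rect (c : Copartition a b m) : c.rect.sum = m * (c.ground.card * c.sky.card) := by
  have sum_filter_ne_zero (s : Multiset ℕ) : (s.filter (fun x => x ≠ 0)).sum = s.sum := by
    induction s using Multiset.induction with
    | empty => rfl
    | cons x s ih => by_cases hx : x = 0 <;> simp_all
  rw [c.rect_eq, sum_filter_ne_zero, Multiset.sum_replicate, smul_eq_mul]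
  ring

theorem size_ofIndices (ha : 0 < a) (hb : 0 < b) (p : Multiset ℕ × Multiset ℕ) :
    (ofIndices ha hb p : Copartition a b m).size = indexSize a b m p := by
  have hsum (c : ℕ) (s : Multiset ℕ) : (s.map (c + m * ·)).sum = c * s.card + m * s.sum := by
    rw [Multiset.sum_map_add, Multiset.sum_map_mul_left, Multiset.map_const',
      Multiset.sum_replicate, Multiset.map_id', smul_eq_mul, mul_comm c]
  rw [size, sum_rect]
  simp only [ofIndices, indexSize, hsum, Multiset.card_map]
  ring

theorem exists_map_eq_of_forall_modEq {s : Multiset ℕ} (hs : ∀ x ∈ s, a ≤ x ∧ x ≡ a [MOD m]) :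
    ∃ t : Multiset ℕ, t.map (a + m * ·) = s := by
  have : CanLift ℕ ℕ (a + m * ·) fun x => a ≤ x ∧ x ≡ a [MOD m] := by
    refine ⟨fun x ⟨hle, hmod⟩ => ?_⟩
    obtain ⟨i, hi⟩ := (Nat.modEq_iff_dvd' hle).1 hmod.symm
    exact ⟨i, by omega⟩
  exact CanLift.prf s hs

theorem ofIndices_bijective (ha : 0 < a) (hb : 0 < b) (hm : 0 < m) :
    Function.Bijective (ofIndices ha hb : _ → Copartition a b m) := by
  have hinj (c : ℕ) : Function.Injective (Multiset.map (c + m * ·)) :=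
    Multiset.map_injective fun i j h => Nat.eq_of_mul_eq_mul_left hm (Nat.add_left_cancel h)
  refine ⟨fun p q h => ?_, fun c => ?_⟩
  · exact Prod.ext (hinj a (congrArg ground h)) (hinj b (congrArg sky h))
  · obtain ⟨g, hg⟩ := exists_map_eq_of_forall_modEq c.ground_parts
    obtain ⟨s, hs⟩ := exists_map_eq_of_forall_modEq c.sky_parts
    exact ⟨(g, s), Copartition.ext hg (by simp only [ofIndices, hg, hs, c.rect_eq]) hs⟩

/-- Copartitions of size `n` correspond to pairs of index multisets of size `n`. -/
noncomputable def indicesEquiv (ha : 0 < a) (hb : 0 < b) (hm : 0 < m) (n : ℕ) :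
    {p // indexSize a b m p = n} ≃ {c : Copartition a b m // c.size = n} :=
  (Equiv.ofBijective _ (ofIndices_bijective ha hb hm)).subtypeEquiv fun p => by
    rw [Equiv.ofBijective_apply, size_ofIndices]

theorem indexSize_swap (p : Multiset ℕ × Multiset ℕ) :
    indexSize b a m p.swap = indexSize a b m p := by
  simp only [indexSize, Prod.fst_swap, Prod.snd_swap]
  ring

theorem eq_zero_of_indexSize_lt_min {p : Multiset ℕ × Multiset ℕ}
    (h : indexSize a b m p < min a b) : p = 0 := by
  obtain ⟨h1, h2⟩ := lt_min_iff.1 h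
  simp only [indexSize] at h1 h2
  refine Prod.ext (Multiset.card_eq_zero.1 ?_) (Multiset.card_eq_zero.1 ?_)
  · by_contra hg
    have := Nat.le_mul_of_pos_right a (Nat.pos_of_ne_zero hg)
    omega
  · by_contra hs
    have := Nat.le_mul_of_pos_right b (Nat.pos_of_ne_zero hs)
    omega

theorem bijective_cons_zero_map_succ :
    Function.Bijective (Sum.elim (0 ::ₘ ·) (Multiset.map (· + 1)) :
      Multiset ℕ ⊕ Multiset ℕ → Multiset ℕ) := by
  have hzero (s : Multiset ℕ) : 0 ∉ s.map (· + 1) := by simp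
  constructor
  · refine Function.Injective.sumElim (fun _ _ => (Multiset.cons_inj_right 0).1)
      (Multiset.map_injective (add_left_injective 1)) fun s t h => hzero t ?_
    rw [← h]
    exact Multiset.mem_cons_self 0 s
  · intro s
    by_cases h : 0 ∈ s
    · exact ⟨Sum.inl (s.erase 0), Multiset.cons_erase h⟩
    · have : CanLift ℕ ℕ (· + 1) (· ≠ 0) := ⟨fun x hx => ⟨x - 1, Nat.succ_pred hx⟩⟩
      obtain ⟨t, rfl⟩ := CanLift.prf (β := Multiset ℕ) s fun x hx => ne_of_mem_of_not_mem hx h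
      exact ⟨Sum.inr t, rfl⟩

/-- Pairs of multisets, split according to whether the first one contains `0`; if it does, one
copy of `0` is removed, and otherwise all its elements are lowered by `1`. -/
noncomputable def splitIndices :
    (Multiset ℕ × Multiset ℕ) ⊕ (Multiset ℕ × Multiset ℕ) ≃ Multiset ℕ × Multiset ℕ :=
  (Equiv.sumProdDistrib _ _ _).symm.trans
    ((Equiv.ofBijective _ bijective_cons_zero_map_succ).prodCongr (Equiv.refl _))

theorem indexSize_splitIndices (x : (Multiset ℕ × Multiset ℕ) ⊕ (Multiset ℕ × Multiset ℕ)) :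
    indexSize a b m (splitIndices x) =
      Sum.elim (fun p => indexSize a (b + m) m p + a) (indexSize (a + m) b m) x := by
  rcases x with ⟨g, s⟩ | ⟨g, s⟩
  · change indexSize a b m (0 ::ₘ g, s) = _
    simp only [indexSize, Multiset.card_cons, Multiset.sum_cons, Sum.elim_inl]
    ring
  · change indexSize a b m (g.map (· + 1), s) = _
    simp only [indexSize, Multiset.card_map, Multiset.sum_map_add, Multiset.map_id',
      Multiset.map_const', Multiset.sum_replicate, smul_eq_mul, Sum.elim_inr]
    ring

end Indices

end Copartition

section Counting

open Copartition

variable {a b m : ℕ}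

theorem cp_eq_card_indexSize (ha : 0 < a) (hb : 0 < b) (hm : 0 < m) (n : ℕ) :
    cp a b m n = Nat.card {p // indexSize a b m p = n} :=
  (Nat.card_congr (indicesEquiv ha hb hm n)).symm

theorem cp_comm (ha : 0 < a) (hb : 0 < b) (hm : 0 < m) (n : ℕ) : cp a b m n = cp b a m n := by
  rw [cp_eq_card_indexSize ha hb hm, cp_eq_card_indexSize hb ha hm]
  exact Nat.card_congr <| (Equiv.prodComm _ _).subtypeEquiv fun p => by
    rw [Equiv.prodComm_apply, indexSize_swap]

theorem cp_of_lt_min {n : ℕ} (hm : 0 < m) (hn : n < min a b) :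
    cp a b m n = if n = 0 then 1 else 0 := by
  rw [cp_eq_card_indexSize (by omega) (by omega) hm]
  split_ifs with h
  · subst h
    rw [Nat.card_eq_one_iff_unique]
    exact ⟨⟨fun p q => Subtype.ext <| (eq_zero_of_indexSize_lt_min (p.2.trans_lt hn)).trans
      (eq_zero_of_indexSize_lt_min (q.2.trans_lt hn)).symm⟩, ⟨0, by simp [indexSize]⟩⟩
  · rw [Nat.card_eq_zero]
    refine Or.inl ⟨fun p => h ?_⟩
    rw [← p.2, eq_zero_of_indexSize_lt_min (p.2.trans_lt hn)]
    simp [indexSize]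

theorem cp_recurrence (ha : 0 < a) (hb : 0 < b) (hm : 0 < m) (n : ℕ) :
    cp a b m n = (if a ≤ n then cp a (b + m) m (n - a) else 0) + cp (a + m) b m n := by
  have hbm : 0 < b + m := by omega
  have ham : 0 < a + m := by omega
  have hleft : Nat.card {p // indexSize a (b + m) m p + a = n} =
      if a ≤ n then cp a (b + m) m (n - a) else 0 := by
    split_ifs with h
    · rw [cp_eq_card_indexSize ha hbm hm]
      exact Nat.card_congr (Equiv.subtypeEquivRight fun p => by omega)
    · exact Nat.card_eq_zero.2 (Or.inl ⟨fun p => by have := p.2; omega⟩)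
  have hsplit : {p // indexSize a b m p = n} ≃
      {p // indexSize a (b + m) m p + a = n} ⊕ {p // indexSize (a + m) b m p = n} :=
    (splitIndices.subtypeEquiv fun x => by rw [indexSize_splitIndices]).symm.trans
      Equiv.subtypeSum
  have : Finite {p // indexSize a b m p = n} := .of_equiv _ (indicesEquiv ha hb hm n).symm
  have := Finite.of_equiv _ hsplit
  have := Finite.sum_left (α := {p // indexSize a (b + m) m p + a = n})
    {p // indexSize (a + m) b m p = n}
  have := Finite.of_equiv _ (indicesEquiv ham hb hm n).symm
  rw [cp_eq_card_indexSize ha hb hm, Nat.card_congr hsplit, Nat.card_sum, hleft,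
    cp_eq_card_indexSize ham hb hm]

end Counting

open PowerSeries PowerSeries.WithPiTopology Filter Topology

section QPochhammer

variable (R : Type*) [CommRing R] [TopologicalSpace R]

/-- The `q`-Pochhammer symbol `(q ^ s; q ^ m)_∞ = ∏ (1 - q ^ (s + m * i))`, over `i ≥ 0`, as a power
series in `q`. -/
noncomputable def qPochhammer (s m : ℕ) : R⟦X⟧ := ∏' i : ℕ, (1 - X ^ (s + m * i))

variable {R} {m : ℕ}

theorem multipliable_one_sub_X_pow_progression (hm : 0 < m) (s : ℕ) :
    Multipliable fun i : ℕ => (1 - X ^ (s + m * i) : R⟦X⟧) := by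
  nontriviality R
  simp_rw [sub_eq_add_neg]
  apply multipliable_one_add_of_tendsto_order_atTop_nhds_top
  simp_rw [order_neg, order_X_pow]
  exact ENat.tendsto_natCast_nhds_top.comp <| tendsto_atTop_mono
    (fun i => (Nat.le_mul_of_pos_left i hm).trans (Nat.le_add_left _ s)) tendsto_id

theorem hasProd_qPochhammer (hm : 0 < m) (s : ℕ) :
    HasProd (fun i : ℕ => (1 - X ^ (s + m * i) : R⟦X⟧)) (qPochhammer R s m) :=
  (multipliable_one_sub_X_pow_progression hm s).hasProd

variable [T2Space R]

theorem qPochhammer_one_one : qPochhammer R 1 1 = pentagonalSeries R := by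
  simp only [qPochhammer, one_mul, add_comm 1, tprod_one_sub_X_pow]

theorem X_pow_dvd_qPochhammer_sub_one (hm : 0 < m) (s : ℕ) : X ^ s ∣ qPochhammer R s m - 1 := by
  have hprod (N : Finset ℕ) : (X ^ s : R⟦X⟧) ∣ ∏ i ∈ N, (1 - X ^ (s + m * i)) - 1 := by
    refine Finset.prod_induction _ (X ^ s ∣ · - 1) (fun f g hf hg => ?_) (by simp) fun i _ => ?_
    · rw [show f * g - 1 = f * (g - 1) + (f - 1) by ring]
      exact dvd_add (hg.mul_left f) hf
    · simp [pow_add]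
  rw [X_pow_dvd_iff]
  intro j hj
  have hlim := (tendsto_iff_coeff_tendsto _ _ _ _).1 (hasProd_qPochhammer (R := R) hm s) j
  rw [map_sub, sub_eq_zero]
  refine tendsto_nhds_unique hlim (tendsto_const_nhds.congr fun N => ?_)
  rw [eq_comm, ← sub_eq_zero, ← map_sub]
  exact X_pow_dvd_iff.1 (hprod N) j hj

theorem isUnit_qPochhammer (hm : 0 < m) {s : ℕ} (hs : 0 < s) : IsUnit (qPochhammer R s m) := by
  have h := X_pow_dvd_iff.1 (X_pow_dvd_qPochhammer_sub_one (R := R) hm s) 0 hs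
  rw [map_sub, sub_eq_zero, coeff_zero_one, coeff_zero_eq_constantCoeff_apply] at h
  exact isUnit_iff_constantCoeff.2 (h ▸ isUnit_one)

theorem qPochhammer_mul_eq_expand {d : ℕ} (hd : d ≠ 0) (hm : 0 < m) (s : ℕ) :
    qPochhammer R (d * s) (d * m) = expand d hd (qPochhammer R s m) := by
  have hcont : Continuous (expand d hd (R := R)) := by
    refine continuous_iff_continuousAt.2 fun f => (tendsto_iff_coeff_tendsto _ _ _ _).2 fun n => ?_
    simp_rw [coeff_expand]
    split_ifs
    · exact (continuous_coeff R _).tendsto f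
    · exact tendsto_const_nhds
  refine (hasProd_qPochhammer (Nat.mul_pos (Nat.pos_of_ne_zero hd) hm) _).unique ?_
  convert (hasProd_qPochhammer (R := R) hm s).map (expand d hd) hcont using 2 with i
  simp only [Function.comp_apply, map_sub, map_one, map_pow, expand_X, ← pow_mul, mul_add,
    mul_assoc]

variable [IsTopologicalRing R]

theorem qPochhammer_eq_mul (hm : 0 < m) (s : ℕ) :
    qPochhammer R s m = (1 - X ^ s) * qPochhammer R (s + m) m := by
  have hshift (i : ℕ) : s + m * (i + 1) = s + m + m * i := by ring
  rw [qPochhammer, tprod_eq_zero_mul'] <;> simp only [hshift]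
  · simp [qPochhammer]
  · exact multipliable_one_sub_X_pow_progression hm _

theorem qPochhammer_eq_prod (hm : 0 < m) (k : ℕ) [NeZero k] (s : ℕ) :
    qPochhammer R s m = ∏ j : Fin k, qPochhammer R (s + m * j) (k * m) := by
  have hresidues := (((Nat.divModEquiv k).trans (Equiv.prodComm _ _)).symm.hasProd_iff).2
    (hasProd_qPochhammer (R := R) hm s)
  refine (hresidues.prod_fiberwise fun j => ?_).unique (hasProd_fintype _)
  convert hasProd_qPochhammer (R := R) (Nat.mul_pos (NeZero.pos k) hm) (s + m * j) using 3 with i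
  simp [Nat.divModEquiv]
  ring

theorem qPochhammer_pow_char (p : ℕ) [Fact p.Prime] [CharP R p] (hm : 0 < m) (s : ℕ) :
    qPochhammer R s m ^ p = qPochhammer R (p * s) (p * m) := by
  have hp := (Fact.out : p.Prime).pos
  refine HasProd.unique ?_ (hasProd_qPochhammer (Nat.mul_pos hp hm) (p * s))
  have : CharP R⟦X⟧ p := charP_of_injective_ringHom C_injective p
  rw [← powMonoidHom_apply]
  convert (hasProd_qPochhammer (R := R) hm s).map (powMonoidHom p) (continuous_pow p) using 2 with i
  simp only [Function.comp_apply, powMonoidHom_apply, sub_pow_char, one_pow, ← pow_mul]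
  ring_nf

/-- In characteristic `2`, Euler's identity between partitions into odd and into distinct parts:
`∏ (1 - q ^ (2 i + 1)) = 1 / ∏ (1 + q ^ i)`. -/
theorem qPochhammer_two_mul_mul_self [CharP R 2] (hm : 0 < m) :
    qPochhammer R m (2 * m) * qPochhammer R m m = 1 := by
  have hsplit : qPochhammer R m m =
      qPochhammer R m (2 * m) * qPochhammer R (2 * m) (2 * m) := by
    simpa [Fin.prod_univ_two, two_mul] using qPochhammer_eq_prod (R := R) hm 2 m
  rw [← qPochhammer_pow_char 2 hm] at hsplit
  apply (isUnit_qPochhammer (R := R) hm hm).mul_left_cancel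
  linear_combination -hsplit

end QPochhammer

section GeneratingFunction

/-- The generating function `∑ cp a b m n * q ^ n` of the numbers of copartitions, with
coefficients in `R`. -/
noncomputable def cpSeries (R : Type*) [Semiring R] (a b m : ℕ) : R⟦X⟧ :=
  mk fun n => (cp a b m n : R)

variable {R : Type*} [CommRing R] {a b m : ℕ}

theorem cpSeries_comm (ha : 0 < a) (hb : 0 < b) (hm : 0 < m) :
    cpSeries R a b m = cpSeries R b a m := by
  simp only [cpSeries, cp_comm ha hb hm]

theorem cpSeries_recurrence (ha : 0 < a) (hb : 0 < b) (hm : 0 < m) :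
    cpSeries R a b m = X ^ a * cpSeries R a (b + m) m + cpSeries R (a + m) b m := by
  ext n
  simp only [cpSeries, map_add, coeff_X_pow_mul', coeff_mk, cp_recurrence ha hb hm n]
  split_ifs <;> simp

theorem X_pow_dvd_cpSeries_sub_one (hm : 0 < m) : X ^ min a b ∣ cpSeries R a b m - 1 := by
  rw [X_pow_dvd_iff]
  intro n hn
  rw [map_sub, cpSeries, coeff_mk, cp_of_lt_min hm hn, coeff_one]
  split_ifs <;> simp

/-- Divisibility of all `D a b` by `X ^ n` improves to `X ^ (n + 1)` at `(a, b)` once it holds at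
`(a + m, b)`, hence by symmetry once it holds at `(a + m * k, b + m * k)` for some `k`; there it
holds for large `k` since `D a b` vanishes to order `min a b`. -/
theorem eq_zero_of_shift_recurrence (hm : 0 < m) {D u v : ℕ → ℕ → R⟦X⟧}
    (hcomm : ∀ a b, 0 < a → 0 < b → D a b = D b a)
    (hrec : ∀ a b, 0 < a → 0 < b → D a b = X ^ a * (u a b * D a (b + m)) + v a b * D (a + m) b)
    (hdvd : ∀ a b, X ^ min a b ∣ D a b) (ha : 0 < a) (hb : 0 < b) : D a b = 0 := by
  suffices h : ∀ n a b, 0 < a → 0 < b → X ^ n ∣ D a b by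
    ext n
    exact X_pow_dvd_iff.1 (h (n + 1) a b ha hb) n n.lt_succ_self
  intro n
  induction n with
  | zero => simp
  | succ n ih =>
    have left (a b : ℕ) (ha : 0 < a) (hb : 0 < b) (h : X ^ (n + 1) ∣ D (a + m) b) :
        X ^ (n + 1) ∣ D a b := by
      rw [hrec a b ha hb]
      refine dvd_add ?_ (h.mul_left _)
      rw [pow_succ']
      exact mul_dvd_mul (dvd_pow_self X ha.ne') ((ih a (b + m) ha (by omega)).mul_left _)
    have both (a b : ℕ) (ha : 0 < a) (hb : 0 < b) (h : X ^ (n + 1) ∣ D (a + m) (b + m)) :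
        X ^ (n + 1) ∣ D a b := by
      refine left a b ha hb ?_
      rw [hcomm _ _ (by omega) hb]
      refine left b (a + m) hb (by omega) ?_
      rwa [hcomm _ _ (by omega) (by omega)]
    have iterate (k : ℕ) : ∀ a b, 0 < a → 0 < b →
        X ^ (n + 1) ∣ D (a + m * k) (b + m * k) → X ^ (n + 1) ∣ D a b := by
      induction k with
      | zero => simp
      | succ k ihk =>
        intro a b ha hb h
        refine both a b ha hb (ihk _ _ (by omega) (by omega) ?_)
        convert h using 2 <;> ring
    intro a b ha hb
    refine iterate (n + 1) a b ha hb ((pow_dvd_pow X ?_).trans (hdvd _ _))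
    have := Nat.le_mul_of_pos_left (n + 1) hm
    omega

variable [TopologicalSpace R] [T2Space R]

theorem X_pow_dvd_cpSeries_mul_sub (hm : 0 < m) (a b : ℕ) :
    X ^ min a b ∣ cpSeries R a b m * (qPochhammer R a m * qPochhammer R b m) -
      qPochhammer R (a + b) m := by
  have hC := X_pow_dvd_cpSeries_sub_one (R := R) (a := a) (b := b) hm
  have hP {s : ℕ} (hs : min a b ≤ s) : X ^ min a b ∣ qPochhammer R s m - 1 :=
    (pow_dvd_pow X hs).trans (X_pow_dvd_qPochhammer_sub_one hm s)
  have ha := hP (min_le_left a b)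
  have hb := hP (min_le_right a b)
  have hab := hP ((min_le_left a b).trans (Nat.le_add_right a b))
  simp only [← Ideal.mem_span_singleton, ← Ideal.Quotient.eq, map_mul, map_one] at *
  rw [hC, ha, hb, hab, one_mul, one_mul]

variable [IsTopologicalRing R]

theorem cpSeries_mul_qPochhammer (ha : 0 < a) (hb : 0 < b) (hm : 0 < m) :
    cpSeries R a b m * (qPochhammer R a m * qPochhammer R b m) = qPochhammer R (a + b) m := by
  rw [← sub_eq_zero]
  refine eq_zero_of_shift_recurrence (a := a) (b := b) hm
    (D := fun a b => cpSeries R a b m * (qPochhammer R a m * qPochhammer R b m) -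
      qPochhammer R (a + b) m)
    (u := fun _ b => 1 - X ^ b) (v := fun a _ => 1 - X ^ a) (fun a b ha hb => ?_)
    (fun a b ha hb => ?_) (X_pow_dvd_cpSeries_mul_sub hm) ha hb
  · rw [cpSeries_comm ha hb hm, add_comm a b, mul_comm (qPochhammer R a m)]
  · rw [cpSeries_recurrence ha hb hm, qPochhammer_eq_mul hm (a + b), ← add_assoc a b m,
      add_right_comm a m b, pow_add]
    linear_combination
      X ^ a * cpSeries R a (b + m) m * qPochhammer R a m * qPochhammer_eq_mul (R := R) hm b +
      cpSeries R (a + m) b m * qPochhammer R b m * qPochhammer_eq_mul (R := R) hm a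

theorem cpSeries_three_one_four [CharP R 2] :
    cpSeries R 3 1 4 = qPochhammer R 1 1 * qPochhammer R 4 4 := by
  have hcp : cpSeries R 3 1 4 * (qPochhammer R 3 4 * qPochhammer R 1 4) = qPochhammer R 4 4 :=
    cpSeries_mul_qPochhammer three_pos one_pos four_pos
  have hodd : qPochhammer R 1 2 * qPochhammer R 1 1 = 1 := qPochhammer_two_mul_mul_self one_pos
  have hsplit : qPochhammer R 1 2 = qPochhammer R 1 4 * qPochhammer R 3 4 := by
    simpa [Fin.prod_univ_two] using qPochhammer_eq_prod (R := R) two_pos 2 1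
  linear_combination qPochhammer R 1 1 * hcp - cpSeries R 3 1 4 * hodd +
    cpSeries R 3 1 4 * qPochhammer R 1 1 * hsplit

theorem cpSeries_five_one_six [CharP R 2] :
    cpSeries R 5 1 6 = qPochhammer R 1 1 * qPochhammer R 3 3 := by
  have hcp : cpSeries R 5 1 6 * (qPochhammer R 5 6 * qPochhammer R 1 6) = qPochhammer R 6 6 :=
    cpSeries_mul_qPochhammer (by norm_num) one_pos (by norm_num)
  have hodd : qPochhammer R 1 2 * qPochhammer R 1 1 = 1 := qPochhammer_two_mul_mul_self one_pos
  have hodd3 : qPochhammer R 3 6 * qPochhammer R 3 3 = 1 := qPochhammer_two_mul_mul_self three_pos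
  have hsq : qPochhammer R 3 3 ^ 2 = qPochhammer R 6 6 := qPochhammer_pow_char 2 three_pos 3
  have hsplit : qPochhammer R 1 2 =
      qPochhammer R 1 6 * qPochhammer R 3 6 * qPochhammer R 5 6 := by
    simpa [Fin.prod_univ_three] using qPochhammer_eq_prod (R := R) two_pos 3 1
  calc cpSeries R 5 1 6
      = cpSeries R 5 1 6 * (qPochhammer R 1 2 * qPochhammer R 1 1) := by rw [hodd, mul_one]
    _ = cpSeries R 5 1 6 * (qPochhammer R 5 6 * qPochhammer R 1 6) *
          qPochhammer R 1 1 * qPochhammer R 3 6 := by rw [hsplit]; ring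
    _ = qPochhammer R 1 1 * qPochhammer R 3 3 *
          (qPochhammer R 3 6 * qPochhammer R 3 3) := by rw [hcp, ← hsq]; ring
    _ = qPochhammer R 1 1 * qPochhammer R 3 3 := by rw [hodd3, mul_one]

end GeneratingFunction

section Coefficients

variable {R : Type*} [CommRing R] [TopologicalSpace R] [T2Space R]

theorem exists_eq_mul_pentagonal_of_coeff_ne_zero {d n : ℕ} (hd : d ≠ 0)
    (h : coeff n (qPochhammer R d d) ≠ 0) : ∃ k : ℤ, n = d * pentagonal k := by
  have hexpand : qPochhammer R d d = expand d hd (pentagonalSeries R) := by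
    simpa [qPochhammer_one_one] using qPochhammer_mul_eq_expand (R := R) hd one_pos 1
  rw [hexpand, coeff_expand] at h
  split_ifs at h with hdvd
  · obtain ⟨q, rfl⟩ := hdvd
    rw [Nat.mul_div_cancel_left _ (Nat.pos_of_ne_zero hd)] at h
    obtain ⟨k, rfl⟩ := not_imp_comm.1 (coeff_pentagonalSeries_eq_zero R) h
    exact ⟨k, rfl⟩
  · exact absurd rfl h

/-- Completing the square turns the pentagonal number `k (3 k - 1) / 2` into
`((6 k - 1) ^ 2 - 1) / 24`. -/
theorem exists_eq_sq_add_sq_of_coeff_ne_zero {c d n : ℕ} (hc : c ≠ 0) (hd : d ≠ 0)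
    (h : coeff n (qPochhammer R c c * qPochhammer R d d) ≠ 0) :
    ∃ x y : ℤ, (24 * n + c + d : ℤ) = c * x ^ 2 + d * y ^ 2 := by
  rw [coeff_mul] at h
  obtain ⟨p, hp, hne⟩ := Finset.exists_ne_zero_of_sum_ne_zero h
  obtain ⟨i, hi⟩ := exists_eq_mul_pentagonal_of_coeff_ne_zero hc (left_ne_zero_of_mul hne)
  obtain ⟨j, hj⟩ := exists_eq_mul_pentagonal_of_coeff_ne_zero hd (right_ne_zero_of_mul hne)
  refine ⟨6 * i - 1, 6 * j - 1, ?_⟩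
  rw [← Finset.HasAntidiagonal.mem_antidiagonal.1 hp, hi, hj]
  push_cast
  linear_combination 12 * c * two_mul_natCast_pentagonal i +
    12 * d * two_mul_natCast_pentagonal j

end Coefficients

theorem sq_dvd_sq_sub_mul_sq {p : ℕ} [Fact p.Prime] {a x y : ℤ} (ha : legendreSym p a = -1)
    (h : (p : ℤ) ∣ x ^ 2 - a * y ^ 2) : (p : ℤ) ^ 2 ∣ x ^ 2 - a * y ^ 2 := by
  obtain ⟨hx, hy⟩ := legendreSym.prime_dvd_of_eq_neg_one ha h
  exact dvd_sub (pow_dvd_pow_of_dvd hx 2) ((pow_dvd_pow_of_dvd hy 2).mul_left a)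

theorem even_cp_of_cpSeries_eq {a b m d n p : ℕ} [Fact p.Prime] (hd : d ≠ 0)
    (hcp : cpSeries (ZMod 2) a b m = qPochhammer (ZMod 2) 1 1 * qPochhammer (ZMod 2) d d)
    (hleg : legendreSym p (-d) = -1) (hdvd : p ∣ 24 * n + 1 + d)
    (hsq : ¬ p ^ 2 ∣ 24 * n + 1 + d) : Even (cp a b m n) := by
  rw [← ZMod.natCast_eq_zero_iff_even]
  by_contra hodd
  have hcoeff : coeff n (qPochhammer (ZMod 2) 1 1 * qPochhammer (ZMod 2) d d) ≠ 0 := by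
    rwa [← hcp, cpSeries, coeff_mk]
  obtain ⟨x, y, hxy⟩ := exists_eq_sq_add_sq_of_coeff_ne_zero one_ne_zero hd hcoeff
  have hform : ((24 * n + 1 + d : ℕ) : ℤ) = x ^ 2 - -d * y ^ 2 := by
    push_cast at hxy ⊢
    linear_combination hxy
  apply hsq
  zify at hdvd ⊢
  push_cast at hform
  rw [hform] at hdvd ⊢
  exact sq_dvd_sq_sub_mul_sq hleg hdvd

theorem mainTheorem12_general {p : ℕ} [Fact p.Prime] (n : ℕ) :
    (legendreSym p (-4) = -1 → p ∣ 24 * n + 5 → ¬ p ^ 2 ∣ 24 * n + 5 → Even (cp 3 1 4 n)) ∧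
    (legendreSym p (-3) = -1 → p ∣ 24 * n + 4 → ¬ p ^ 2 ∣ 24 * n + 4 → Even (cp 5 1 6 n)) :=
  ⟨even_cp_of_cpSeries_eq four_ne_zero cpSeries_three_one_four,
    even_cp_of_cpSeries_eq three_ne_zero cpSeries_five_one_six⟩

theorem mainTheorem12 :
    (∀ r ∈ ({3, 14, 36, 47, 58, 69, 80, 91, 102, 113} : Finset ℕ), ∀ k : ℕ,
      Even (cp 3 1 4 (121 * k + r))) ∧
    (∀ r ∈ ({9, 31, 42, 53, 64, 75, 86, 97, 108, 119} : Finset ℕ), ∀ k : ℕ,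
      Even (cp 5 1 6 (121 * k + r))) := by
  have : Fact (Nat.Prime 11) := ⟨by norm_num⟩
  constructor <;> intro r hr k <;> simp only [Finset.mem_insert, Finset.mem_singleton] at hr
  · exact (mainTheorem12_general (p := 11) _).1 (by norm_num) (by omega) (by omega)
  · exact (mainTheorem12_general (p := 11) _).2 (by norm_num) (by omega) (by omega)
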